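/- \textbf{Theorem (Gallai's theorem with polynomial constraints).} A \emph{homothetic copy} of a set $T\subseteq\mathbb{R}^d$ is a set of the form $p^*+\lambda T=\{p^*+\lambda p: p\in T\}$ with $p^*\in\mathbb{R}^d$ and $\lambda>0$. A family $\mathcal{F}$ of $2d$-variate real polynomials \emph{respects} a set $X\subseteq\mathbb{R}^d$ if $f(p,q)\neq 0$ for all $f\in\mathcal{F}$ and all pairs of distinct points $p,q\in X$. A \emph{cycle} of length $\ell\geq 2$ on a set $X$ is a tuple $(T_1,\ldots,T_\ell)$ of distinct subsets of $X$ such that there exist distinct elements $x_1,\ldots,x_\ell\in X$ with $x_i\in T_i\cap T_{i+1}$ for $1\leq i\leq \ell-1$ and $x_\ell\in T_\ell\cap T_1$. Let $T$ be a finite subset of $\mathbb{R}^d$ of size at least $3$, let $\mathcal{F}$ be a countable family of $2d$-variate real polynomials that respects $T$, and let $g$ and $k$ be positive integers. Then there exist a finite set $X\subset\mathbb{R}^d$ and a collection $\mathcal{T}$ of homothetic copies of $T$, each contained in $X$, satisfying the following conditions: \begin{enumerate} \item $\mathcal{F}$ respects $X$; \item no tuple of fewer than $g$ members of $\mathcal{T}$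 forms a cycle on $X$; \item for every $k$-colouring of $X$, some member of $\mathcal{T}$ is monochromatic. \end{enumerate} -/

import Mathlib

namespace SparseGallai

/-- A family `F` of `2d`-variate real polynomials respects `X ⊆ ℝ^d` if `f(p, q) ≠ 0` for all
`f ∈ F` and all pairs of distinct points `p, q ∈ X`. The first block of `d` variables is indexed by
`Sum.inl`, the second one by `Sum.inr`. -/
def Respects {d : ℕ} (F : Set (MvPolynomial (Fin d ⊕ Fin d) ℝ)) (X : Set (Fin d → ℝ)) : Prop :=
  ∀ f ∈ F, ∀ p ∈ X, ∀ q ∈ X, p ≠ q → MvPolynomial.eval (Sum.elim p q) f ≠ 0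

/-- `S` is a homothetic copy of `T`: the image of `T` under a map `p ↦ v + r • p` with `r > 0`. -/
def IsHomotheticCopy {d : ℕ} (T S : Set (Fin d → ℝ)) : Prop :=
  ∃ (v : Fin d → ℝ) (r : ℝ), 0 < r ∧ S = (fun p => v + r • p) '' T

/-- The tuple `C` of sets is a cycle of length `l ≥ 2` on `X`: its members are distinct subsets
of `X`, and there are distinct `x i ∈ X` with `x i ∈ C i ∩ C (i + 1)`, indices taken cyclically
(`finRotate l` sends `i` to `i + 1` and the last index to the first one). -/
def IsCycle {α : Type*} (X : Set α) {l : ℕ} (C : Fin l → Set α) : Prop :=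
  2 ≤ l ∧ Function.Injective C ∧ (∀ i, C i ⊆ X) ∧
    ∃ x : Fin l → α, Function.Injective x ∧
      ∀ i, x i ∈ X ∧ x i ∈ C i ∩ C (finRotate l i)

/-- `S` is monochromatic in the coloring `c` of `X` (used for `S ⊆ X`). -/
def IsMonochromatic {α κ : Type*} {X : Set α} (c : X → κ) (S : Set α) : Prop :=
  ∀ p q : X, (p : α) ∈ S → (q : α) ∈ S → c p = c q

end SparseGallai

/-!
The proof combines a sparse version of the Hales–Jewett theorem with a generic projection.

*Projection.* Let `z` range over the cube `T ^ ι` and send it to `∑ i, γ i • z i`, with positive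
weights `γ i`. This takes combinatorial lines to homothetic copies of `T`. For `z ≠ z'` and `f` in
the family, the value of `f` at the images of `z` and `z'` is a polynomial in `γ`. It is not the
zero polynomial: give weight `1` to one coordinate `i` with `z i ≠ z' i` and weight `0` to the
others; the value is then `f (z i, z' i) ≠ 0`. Only countably many polynomials arise, so by Baire
some positive `γ` is a root of none of them (`exists_weights_injective_respects`). It remains to
find, over every finite alphabet, a set of lines of large girth that contains a monochromatic line
for every colouring (`sparseHalesJewett`).

*Sparse Hales–Jewett.* The induction is on the girth, for all alphabets simultaneously; the
Hales–Jewett theorem starts it. To raise the girth for the alphabet `A`, take disjoint lines in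
a cube whose points are distributed among finitely many parts, such that every injection of `A` into
the set of parts is realized by a line (`partiteRamsey_empty`). By the pigeonhole principle it
suffices to amalgamate copies of this family so that in some copy each part becomes monochromatic.
This is done one part at a time (`PartiteRamsey.insert`): the points `S ⊆ A ^ ι` of the part serve
as an alphabet, for which the inductive hypothesis provides sparse lines in `S ^ κ`, and each
of these extends to a copy of `A ^ ι` in `A ^ (κ × ι)` (`blowUp`). Distinct copies share points of
the part only (`mem_of_blowUp_eq`), and each line meets the part at most once; hence a short cycle
that is not inside one copy would yield a strictly shorter cycle of lines over `S`.

Girth is expressed by closed trails, whose edges may repeat (`GirthAtLeast`); this makes passing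
from edges to copies harmless.
-/

open Combinatorics Set

namespace SparseGallai

/-! ### Closed trails and girth -/

/-- A closed trail of length `l` in the hypergraph with edges `s b`, `b : β`: a cyclic sequence of
edges `C 0, …, C l = C 0` and *distinct* vertices `x 0, …, x (l - 1)` with
`x i ∈ s (C i) ∩ s (C (i + 1))`. The edges may repeat, unlike those of a cycle. The values of `C`
beyond `l` and of `x` from `l` on are irrelevant. -/
structure IsClosedTrail {α β : Type*} (s : β → Set α) (l : ℕ) (C : ℕ → β) (x : ℕ → α) :
    Prop where
  closed : C l = C 0
  injOn : InjOn x (Iio l)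
  mem : ∀ i < l, x i ∈ s (C i)
  mem_succ : ∀ i < l, x i ∈ s (C (i + 1))

/-- The hypergraph `s` has girth at least `g`, in the form suited to inductive arguments: each
closed trail of length less than `g` uses a single edge only. As a cycle is a closed trail with
distinct edges, this excludes cycles of length less than `g`. -/
def GirthAtLeast {α β : Type*} (s : β → Set α) (g : ℕ) : Prop :=
  ∀ l < g, ∀ C x, IsClosedTrail s l C x → ∀ i ≤ l, C i = C 0

section Trails

variable {α β γ : Type*} {s : β → Set α} {l g : ℕ} {C : ℕ → β} {x : ℕ → α}

lemma girthAtLeast_two (s : β → Set α) : GirthAtLeast s 2 := by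
  intro l hl C x h i hi
  obtain rfl | rfl : i = 0 ∨ i = l := by omega
  · rfl
  · exact h.closed

/-- The girth of an indexed family bounds that of the same family with repetitions removed. -/
lemma GirthAtLeast.of_surjective {f : γ → β} (hf : f.Surjective)
    (h : GirthAtLeast (s ∘ f) g) : GirthAtLeast s g := by
  intro l hl C x hC i hi
  have hr := Function.rightInverse_surjInv hf
  have key := h l hl (fun j => Function.surjInv hf (C j)) x
    ⟨by simp only [hC.closed], hC.injOn, fun j hj => by simpa [hr (C j)] using hC.mem j hj,
      fun j hj => by simpa [hr (C (j + 1))] using hC.mem_succ j hj⟩ i hi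
  rw [← hr (C i), ← hr (C 0)]
  exact congrArg f key

/-- Where two consecutive edges of a closed trail coincide, the vertex between them can be
deleted. -/
lemma IsClosedTrail.delete (h : IsClosedTrail s (l + 1) C x) {i : ℕ} (hi : i ≤ l)
    (hC : C i = C (i + 1)) :
    IsClosedTrail s l (fun m => if m ≤ i then C m else C (m + 1))
      (fun m => if m < i then x m else x (m + 1)) where
  closed := by
    by_cases hl : l ≤ i
    · obtain rfl : i = l := le_antisymm hi hl
      simp [hC, h.closed]
    · simp [hl, h.closed]
  injOn := by
    intro a ha b hb hab
    simp only [mem_Iio] at ha hb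
    dsimp only at hab
    split_ifs at hab with h1 h2 h2 <;>
      have := h.injOn (by simp; omega) (by simp; omega) hab <;> omega
  mem m hm := by
    rcases lt_trichotomy m i with hmi | rfl | hmi
    · simpa [hmi, hmi.le] using h.mem m (by omega)
    · simpa [hC] using h.mem (m + 1) (by omega)
    · simpa [hmi.not_ge, hmi.not_gt] using h.mem (m + 1) (by omega)
  mem_succ m hm := by
    by_cases hmi : m < i
    · simpa [hmi, Nat.succ_le_of_lt hmi] using h.mem_succ m (by omega)
    · have : ¬ m + 1 ≤ i := by omega
      simpa [hmi, this] using h.mem_succ (m + 1) (by omega)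

/-- Girth at least `g` also controls the closed trails of length `g` in which two consecutive edges
coincide. -/
lemma GirthAtLeast.const_of_eq_succ (hs : GirthAtLeast s g) (hl : l ≤ g)
    (h : IsClosedTrail s l C x) {i : ℕ} (hi : i < l) (hC : C i = C (i + 1)) :
    ∀ j ≤ l, C j = C 0 := by
  obtain ⟨l, rfl⟩ : ∃ m, l = m + 1 := ⟨l - 1, by omega⟩
  have key := hs l (by omega) _ _ (h.delete (by omega) hC)
  have below : ∀ j ≤ i, C j = C 0 := fun j hj => by simpa [hj] using key j (by omega)
  intro j hj
  rcases le_or_gt j i with hji | hji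
  · exact below j hji
  obtain rfl | hji : j = i + 1 ∨ i + 1 < j := by omega
  · rw [← hC, below i le_rfl]
  · have := key (j - 1) (by omega)
    rwa [if_neg (by omega), if_pos (Nat.zero_le _), Nat.sub_add_cancel (by omega)] at this

lemma GirthAtLeast.mono {g' : ℕ} (hs : GirthAtLeast s g) (hg : g' ≤ g) : GirthAtLeast s g' :=
  fun l hl => hs l (hl.trans_le hg)

/-- To lift a closed trail along a map `u` of vertex sets, it is enough to lift its vertices. -/
lemma IsClosedTrail.lift {α' β' : Type*} {s' : β' → Set α'} {C' : ℕ → β'}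
    (h : IsClosedTrail s l C x) (hl : 0 < l) (hC' : C' l = C' 0) (u : α' → α)
    (hu : ∀ i < l, ∃ z, u z = x i ∧ z ∈ s' (C' i) ∧ z ∈ s' (C' (i + 1))) :
    ∃ z, IsClosedTrail s' l C' z := by
  obtain ⟨z₀, -⟩ := hu 0 hl
  have : Nonempty α' := ⟨z₀⟩
  choose! z hz hz₁ hz₂ using hu
  refine ⟨z, hC', fun i hi j hj hij => h.injOn hi hj ?_, hz₁, hz₂⟩
  rw [← hz i hi, ← hz j hj, hij]

/-- A hypergraph with pairwise disjoint edges has infinite girth. -/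
lemma girthAtLeast_of_disjoint (hs : ∀ b b' a, a ∈ s b → a ∈ s b' → b = b') :
    GirthAtLeast s g := by
  intro l _ C x h i hi
  induction i with
  | zero => rfl
  | succ i ih =>
    rw [← ih (by omega)]
    exact hs _ _ (x i) (h.mem_succ i (by omega)) (h.mem i (by omega))

end Trails

/-- A short cycle among the images of hyperedges is excluded by their girth. -/
lemma GirthAtLeast.not_isCycle {α β α' : Type*} {s : β → Set α} {g : ℕ} (hs : GirthAtLeast s g)
    {u : α → α'} (hu : Function.Injective u) {X : Set α'} {l : ℕ} {C : Fin l → Set α'}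
    (hl : l < g) (hC : ∀ i, ∃ b, C i = u '' s b) : ¬ IsCycle X C := by
  rintro ⟨hl₂, hinj, -, x, hx, hxC⟩
  have : NeZero l := ⟨by omega⟩
  choose b hb using hC
  have hsucc : ∀ i, finRotate l (Fin.ofNat l i) = Fin.ofNat l (i + 1) := fun i => by
    rw [finRotate_apply]
    ext
    simp [Fin.val_add]
  have hmem : ∀ i, ∃ z, u z = x (Fin.ofNat l i) ∧ z ∈ s (b (Fin.ofNat l i)) ∧
      z ∈ s (b (Fin.ofNat l (i + 1))) := fun i => by
    obtain ⟨h₁, h₂⟩ := (hxC (Fin.ofNat l i)).2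
    rw [hb] at h₁ h₂
    obtain ⟨z, hz, hzx⟩ := h₁
    rw [← hzx, hu.mem_set_image, hsucc] at h₂
    exact ⟨z, hzx, hz, h₂⟩
  choose z hzx hz₁ hz₂ using hmem
  have htrail : IsClosedTrail s l (fun i => b (Fin.ofNat l i)) z := by
    refine ⟨?_, fun i hi j hj hij => ?_, fun i _ => hz₁ i, fun i _ => hz₂ i⟩
    · exact congrArg b (Fin.ext (by simp))
    · have := congrArg Fin.val (hx ((hzx i).symm.trans ((congrArg u hij).trans (hzx j))))
      simpa [Nat.mod_eq_of_lt (mem_Iio.1 hi), Nat.mod_eq_of_lt (mem_Iio.1 hj)] using this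
  have h₁ := hs l hl _ z htrail 1 (by omega)
  have h₂ := congrArg Fin.val (hinj ((hb _).trans ((congrArg (fun b => u '' s b) h₁).trans
    (hb _).symm)))
  simp [Nat.mod_eq_of_lt (show 1 < l by omega)] at h₂

/-! ### Products of combinatorial lines -/

section Product

variable {A ι κ : Type*} {S : Set (ι → A)}

/-- A line `ℓ` over the alphabet `S ⊆ A ^ ι` defines a copy of the whole cube `A ^ ι` inside
`A ^ (κ × ι)`: the point `y` is written at the active coordinates of `ℓ`, and the letters of `ℓ`,
which are elements of `S`, at the others. -/
def blowUp (ℓ : Line S κ) (y : ι → A) : κ × ι → A :=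
  fun p => (ℓ.idxFun p.1).elim y Subtype.val p.2

/-- The embedding of `S ^ κ` into `A ^ (κ × ι)`, where `S ⊆ A ^ ι`. -/
def flatten (z : κ → S) : κ × ι → A := fun p => (z p.1).1 p.2

/-- The image of a line `e` under `blowUp ℓ`, as a line. -/
def prodLine (ℓ : Line S κ) (e : Line A ι) : Line A (κ × ι) where
  idxFun p := (ℓ.idxFun p.1).elim (e.idxFun p.2) fun w => some (w.1 p.2)
  proper := by
    obtain ⟨k, hk⟩ := ℓ.proper
    obtain ⟨i, hi⟩ := e.proper
    exact ⟨(k, i), by simp [hk, hi]⟩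

lemma prodLine_apply (ℓ : Line S κ) (e : Line A ι) (a : A) :
    prodLine ℓ e a = blowUp ℓ (e a) := by
  funext p
  cases h : ℓ.idxFun p.1 <;> simp [prodLine, blowUp, h]

lemma flatten_injective : Function.Injective (flatten : (κ → S) → κ × ι → A) := by
  intro z z' h
  funext k
  exact Subtype.ext (funext fun i => congrFun h (k, i))

lemma blowUp_coe (ℓ : Line S κ) (w : S) : blowUp ℓ w = flatten (ℓ w) := by
  funext p
  cases h : ℓ.idxFun p.1 <;> simp [flatten, blowUp, h]

lemma elim_eq_of_blowUp_eq {ℓ ℓ' : Line S κ} {y y' : ι → A} (h : blowUp ℓ y = blowUp ℓ' y')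
    (k : κ) : (ℓ.idxFun k).elim y Subtype.val = (ℓ'.idxFun k).elim y' Subtype.val :=
  funext fun i => congrFun h (k, i)

lemma blowUp_injective (ℓ : Line S κ) : Function.Injective (blowUp ℓ) := by
  intro y y' h
  obtain ⟨k, hk⟩ := ℓ.proper
  simpa [hk] using elim_eq_of_blowUp_eq h k

/-- Two distinct copies of `A ^ ι` overlap within the copies of `S` only: a letter outside `S`
reveals the active coordinates, and then the whole line. -/
lemma mem_of_blowUp_eq {ℓ ℓ' : Line S κ} (hne : ℓ ≠ ℓ') {y y' : ι → A}
    (h : blowUp ℓ y = blowUp ℓ' y') : y ∈ S := by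
  by_contra hy
  have hk := elim_eq_of_blowUp_eq h
  have hyS : ∀ w : S, y ≠ w := fun w hw => hy (hw ▸ w.2)
  obtain ⟨k₀, hk₀⟩ := ℓ.proper
  obtain rfl : y = y' := by
    have := hk k₀
    cases h' : ℓ'.idxFun k₀ with
    | none => simpa [hk₀, h'] using this
    | some w => exact absurd (by simpa [hk₀, h'] using this) (hyS w)
  refine hne (Line.ext (funext fun k => ?_))
  have := hk k
  cases h₁ : ℓ.idxFun k <;> cases h₂ : ℓ'.idxFun k <;> simp only [h₁, h₂, Option.elim] at this
  · rfl
  · exact absurd this (hyS _)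
  · exact absurd this.symm (hyS _)
  · rw [Subtype.ext this]

/-- Replacing the lines over `S` by copies of the whole cube does not create short cycles. -/
lemma GirthAtLeast.blowUp {E : Set (Line S κ)} {g : ℕ}
    (hE : GirthAtLeast (fun ℓ : E => range (ℓ : Line S κ)) g) :
    GirthAtLeast (fun ℓ : E => range (blowUp (ℓ : Line S κ))) g := by
  induction g with
  | zero => exact fun l hl => absurd hl (Nat.not_lt_zero l)
  | succ g ih =>
    intro l hl C x h
    by_cases hex : ∃ i < l, C i = C (i + 1)
    · obtain ⟨i, hi, hC⟩ := hex
      exact (ih (hE.mono g.le_succ)).const_of_eq_succ (by omega) h hi hC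
    -- Otherwise each vertex lies in two distinct copies, hence on the two underlying lines.
    push Not at hex
    obtain rfl | hl₀ := Nat.eq_zero_or_pos l
    · intro i hi
      rw [Nat.le_zero.1 hi]
    obtain ⟨z, hz⟩ := h.lift (s' := fun ℓ : E => range (ℓ : Line S κ)) hl₀ h.closed flatten
      fun i hi => by
        obtain ⟨y, hy⟩ := h.mem i hi
        obtain ⟨y', hy'⟩ := h.mem_succ i hi
        have hne : (C i : Line S κ) ≠ C (i + 1) := fun h' => hex i hi (Subtype.ext h')
        have hyS := mem_of_blowUp_eq hne (hy.trans hy'.symm)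
        have hyS' := mem_of_blowUp_eq hne.symm (hy'.trans hy.symm)
        rw [show y = (⟨y, hyS⟩ : S) from rfl, blowUp_coe] at hy
        rw [show y' = (⟨y', hyS'⟩ : S) from rfl, blowUp_coe] at hy'
        exact ⟨_, hy, ⟨_, rfl⟩, ⟨_, flatten_injective (hy'.trans hy.symm)⟩⟩
    exact hE l hl C z hz

end Product

/-! ### The partite construction -/

/-- The sparse Hales–Jewett theorem for girth `g`: in some finite-dimensional cube over `A` there
is a set of lines of girth at least `g` that contains a monochromatic line for every colouring. -/
def SparseHalesJewett (g : ℕ) : Prop :=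
  ∀ (A : Type) [Finite A] (K : Type) [Finite K] [Nonempty K],
    ∃ (ι : Type) (_ : Finite ι) (E : Set (Line A ι)),
      GirthAtLeast (fun e : E => range (e : Line A ι)) g ∧
        ∀ c : (ι → A) → K, ∃ e ∈ E, e.IsMono c

/-- There is a finite cube over `A`, partitioned by `π` into parts indexed by `B`, and a family `L`
of lines of girth at least `g`, each meeting each part at most once, such that for every colouring
`c` there are colours `col b` of the parts with this property: each injection `φ : A ↪ B` is
realized by a line whose `a`-th point lies in the part `φ a`, and has the colour of that part
if `φ a ∈ J`. -/
def PartiteRamsey (A B K : Type) (g : ℕ) (J : Finset B) : Prop :=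
  ∃ (ι : Type) (_ : Finite ι) (I : Type) (L : I → Line A ι) (π : (ι → A) → B),
    (∀ e, Function.Injective fun a => π (L e a)) ∧ GirthAtLeast (fun e => range (L e)) g ∧
      ∀ c : (ι → A) → K, ∃ col : B → K, ∀ φ : A ↪ B, ∃ e,
        (∀ a, π (L e a) = φ a) ∧ ∀ a, φ a ∈ J → c (L e a) = col (φ a)

section Partite

variable {A B K : Type} {g : ℕ}

/-- With no condition on the colours, disjoint lines suffice, one for each injection. -/
lemma partiteRamsey_empty [Finite A] [Nontrivial A] [Finite B] [Nonempty K]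
    (hAB : Nonempty (A ↪ B)) : PartiteRamsey A B K g ∅ := by
  classical
  obtain ⟨a₀, a₁, ha⟩ := exists_pair_ne A
  let w : (A ↪ B) → (A ↪ B) → A := fun φ => Function.update (fun _ => a₀) φ a₁
  have hw : Function.Injective w := by
    intro φ ψ h
    by_contra hne
    have := congrFun h φ
    simp [w, hne] at this
    exact ha this.symm
  -- The line of `φ` varies the coordinate `none`; its other coordinates spell out `φ`.
  let L : (A ↪ B) → Line A (Option (A ↪ B)) := fun φ =>
    ⟨fun o => o.elim none fun ψ => some (w φ ψ), none, rfl⟩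
  have hL : ∀ φ a, (fun ψ => L φ a (some ψ)) = w φ := fun φ a => by funext ψ; simp [L]
  have hL' : ∀ φ a, L φ a none = a := fun φ a => by simp [L]
  let π : (Option (A ↪ B) → A) → B := fun z => Function.invFun w (fun ψ => z (some ψ)) (z none)
  have hπ : ∀ φ a, π (L φ a) = φ a := fun φ a => by
    simp only [π, hL, hL', Function.leftInverse_invFun hw φ]
  refine ⟨_, inferInstance, _, L, π, fun φ a b h => φ.injective (by simpa only [hπ] using h), ?_,
    fun c => ⟨fun _ => Classical.arbitrary K, fun φ => ⟨φ, hπ φ, by simp⟩⟩⟩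
  refine girthAtLeast_of_disjoint ?_
  rintro φ ψ _ ⟨a, rfl⟩ ⟨b, h⟩
  apply hw
  rw [← hL φ a, ← hL ψ b, h]

/-- Amalgamation along the part `b`: a sparse set of lines over the alphabet formed by this part
gives copies of the whole partite family that share points of this part only. A cycle that runs
through several copies cannot use all its edges to change between copies, since an edge meets the
part `b` at most once; so it induces a shorter cycle of copies. -/
lemma PartiteRamsey.insert [Finite A] [DecidableEq B] [Finite K] [Nonempty K]
    (hg : SparseHalesJewett g) {J : Finset B} (b : B) (h : PartiteRamsey A B K (g + 1) J) :
    PartiteRamsey A B K (g + 1) (insert b J) := by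
  classical
  obtain ⟨ι, _, I, L, π, hinj, hgirth, hcol⟩ := h
  let S : Set (ι → A) := {y | π y = b}
  obtain ⟨κ, _, E, hE, hmono⟩ := hg S K
  -- A point of a copy has a slice outside the part `b` only if that slice is the point copied.
  let π' : (κ × ι → A) → B := fun z =>
    if h : ∃ k, π (fun i => z (k, i)) ≠ b then π (fun i => z (h.choose, i)) else b
  have hπ' : ∀ (ℓ : Line S κ) y, π' (blowUp ℓ y) = π y := by
    intro ℓ y
    -- The slices of `blowUp ℓ y` are equal to `y` or lie in the part `b`.
    have hs : ∀ k, π (fun i => blowUp ℓ y (k, i)) ≠ b →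
        π (fun i => blowUp ℓ y (k, i)) = π y := by
      intro k hk
      cases hℓ : ℓ.idxFun k with
      | none => simp [blowUp, hℓ]
      | some w => exact absurd (by simpa [blowUp, hℓ] using show π w.1 = b from w.2) hk
    by_cases hex : ∃ k, π (fun i => blowUp ℓ y (k, i)) ≠ b
    · simp only [π', dif_pos hex]
      exact hs _ hex.choose_spec
    · simp only [π', dif_neg hex]
      push Not at hex
      obtain ⟨k, hk⟩ := ℓ.proper
      simpa [blowUp, hk] using (hex k).symm
  refine ⟨κ × ι, inferInstance, E × I, fun p => prodLine p.1.1 (L p.2), π', ?_, ?_, ?_⟩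
  · intro p a a' haa
    exact hinj p.2 (by simpa only [prodLine_apply, hπ'] using haa)
  · intro l hl C x h
    obtain rfl | hl₀ := Nat.eq_zero_or_pos l
    · intro i hi
      rw [Nat.le_zero.1 hi]
    have hx₁ : ∀ i < l, ∃ a, blowUp (C i).1.1 (L (C i).2 a) = x i := fun i hi => by
      obtain ⟨a, ha⟩ := h.mem i hi
      exact ⟨a, by rw [← ha, prodLine_apply]⟩
    have hx₂ : ∀ i < l, ∃ a, blowUp (C (i + 1)).1.1 (L (C (i + 1)).2 a) = x i := fun i hi => by
      obtain ⟨a, ha⟩ := h.mem_succ i hi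
      exact ⟨a, by rw [← ha, prodLine_apply]⟩
    have hcopy : ∀ i ≤ l, (C i).1 = (C 0).1 := by
      obtain ⟨i, hi, hCi⟩ : ∃ i < l, (C i).1 = (C (i + 1)).1 := by
        by_contra! hne
        obtain rfl | hl₁ : l = 1 ∨ 1 < l := by omega
        · exact hne 0 one_pos (by rw [h.closed])
        have hne' : ∀ i < l, ((C i).1 : Line S κ) ≠ (C (i + 1)).1 :=
          fun i hi h' => hne i hi (Subtype.ext h')
        -- The edge `C 1` shares both `x 0` and `x 1` with other copies.
        obtain ⟨a, ha⟩ := hx₁ 0 hl₀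
        obtain ⟨a₀, ha₀⟩ := hx₂ 0 hl₀
        obtain ⟨a₁, ha₁⟩ := hx₁ 1 hl₁
        obtain ⟨a', ha'⟩ := hx₂ 1 hl₁
        have h₀ := mem_of_blowUp_eq (hne' 0 hl₀).symm (ha₀.trans ha.symm)
        have h₁ := mem_of_blowUp_eq (hne' 1 hl₁) (ha₁.trans ha'.symm)
        obtain rfl : a₀ = a₁ := hinj (C 1).2 (Eq.trans h₀ (Eq.symm h₁))
        exact zero_ne_one (h.injOn hl₀ hl₁ (ha₀.symm.trans ha₁))
      refine hE.blowUp.const_of_eq_succ (Nat.le_of_lt_succ hl) (C := fun i => (C i).1) (x := x)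
        ⟨congrArg Prod.fst h.closed, h.injOn, fun i hi => ?_, fun i hi => ?_⟩ hi hCi
      · obtain ⟨a, ha⟩ := hx₁ i hi
        exact ⟨_, ha⟩
      · obtain ⟨a, ha⟩ := hx₂ i hi
        exact ⟨_, ha⟩
    obtain ⟨z, hz⟩ := h.lift (s' := fun e => range (L e)) (C' := fun i => (C i).2) hl₀
      (congrArg Prod.snd h.closed) (blowUp (C 0).1.1) fun i hi => by
        obtain ⟨a, ha⟩ := hx₁ i hi
        obtain ⟨a', ha'⟩ := hx₂ i hi
        rw [hcopy i hi.le] at ha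
        rw [hcopy (i + 1) hi] at ha'
        exact ⟨_, ha, ⟨a, rfl⟩, ⟨a', blowUp_injective _ (ha'.trans ha.symm)⟩⟩
    exact fun i hi => Prod.ext (hcopy i hi) (hgirth l hl _ z hz i hi)
  · intro c
    obtain ⟨ℓ, hℓE, γ, hγ⟩ := hmono fun z => c (flatten z)
    obtain ⟨col, hcol⟩ := hcol fun y => c (blowUp ℓ y)
    refine ⟨Function.update col b γ, fun φ => ?_⟩
    obtain ⟨e, he, heJ⟩ := hcol φ
    refine ⟨(⟨ℓ, hℓE⟩, e), fun a => by rw [prodLine_apply, hπ', he], fun a ha => ?_⟩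
    rw [prodLine_apply]
    by_cases hb : φ a = b
    · have hS : L e a ∈ S := (he a).trans hb
      rw [hb, Function.update_self, ← hγ ⟨_, hS⟩]
      exact congrArg c (blowUp_coe ℓ ⟨_, hS⟩)
    · rw [Function.update_of_ne hb]
      exact heJ a (Finset.mem_of_mem_insert_of_ne ha hb)

end Partite

/-- The sparse Hales–Jewett theorem, for all girths. -/
theorem sparseHalesJewett (g : ℕ) : SparseHalesJewett g := by
  classical
  suffices h : ∀ g, SparseHalesJewett (g + 2) by
    intro A _ K _ _
    obtain ⟨ι, hι, E, hE, hc⟩ := h g A K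
    exact ⟨ι, hι, E, hE.mono (by omega), hc⟩
  clear g
  intro g
  induction g with
  | zero =>
    intro A _ K _ _
    obtain ⟨ι, hι, h⟩ := Line.exists_mono_in_high_dimension A K
    refine ⟨ι, inferInstance, univ, girthAtLeast_two _, fun c => ?_⟩
    obtain ⟨ℓ, hℓ⟩ := h c
    exact ⟨ℓ, mem_univ _, hℓ⟩
  | succ g ih =>
    intro A _ K _ _
    obtain hA | hA := subsingleton_or_nontrivial A
    · -- A single line is monochromatic, having at most one point.
      refine ⟨Unit, inferInstance, {Line.diagonal A Unit},
        girthAtLeast_of_disjoint fun e e' _ _ _ => Subsingleton.elim e e',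
        fun c => ⟨_, rfl, ?_⟩⟩
      obtain hA | ⟨⟨a⟩⟩ := isEmpty_or_nonempty A
      · exact ⟨Classical.arbitrary K, fun a => hA.elim a⟩
      · exact ⟨c (Line.diagonal A Unit a), fun a' => by rw [Subsingleton.elim a' a]⟩
    · have := Fintype.ofFinite A
      have := Fintype.ofFinite K
      -- With `|K| * |A|` parts, some colour is given to at least `|A|` of them.
      have hB : Nonempty (A ↪ K × A) :=
        ⟨⟨fun a => (Classical.arbitrary K, a), fun a a' h => congrArg Prod.snd h⟩⟩
      have hP : ∀ J : Finset (K × A), PartiteRamsey A (K × A) K (g + 2 + 1) J := by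
        intro J
        induction J using Finset.induction_on with
        | empty => exact partiteRamsey_empty hB
        | insert b J _ hJ => exact hJ.insert ih b
      obtain ⟨ι, hι, I, L, π, -, hgirth, hcol⟩ := hP Finset.univ
      refine ⟨ι, hι, range L, ?_, fun c => ?_⟩
      · exact GirthAtLeast.of_surjective (f := rangeFactorization L) rangeFactorization_surjective
          hgirth
      · obtain ⟨col, hcol⟩ := hcol c
        obtain ⟨γ, hγ⟩ := Fintype.exists_le_card_fiber_of_mul_le_card (n := Fintype.card A) col
          (by rw [Fintype.card_prod])
        obtain ⟨φ⟩ : Nonempty (A ↪ {p : K × A // col p = γ}) :=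
          Function.Embedding.nonempty_of_card_le (by rwa [Fintype.card_subtype])
        obtain ⟨e, -, he⟩ := hcol (φ.trans (Function.Embedding.subtype _))
        exact ⟨L e, ⟨e, rfl⟩, γ, fun a => (he a (Finset.mem_univ _)).trans (φ a).2⟩

/-! ### Generic projections of the cube -/

section Projection

open MvPolynomial

/-- Countably many nonzero polynomials have a common non-root with positive coordinates, by the
Baire category theorem. -/
lemma exists_pos_forall_eval_ne_zero {ι J : Type*} [Finite ι] [Countable J]
    (P : J → MvPolynomial ι ℝ) (hP : ∀ j, P j ≠ 0) :
    ∃ γ : ι → ℝ, (∀ i, 0 < γ i) ∧ ∀ j, eval γ (P j) ≠ 0 := by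
  have := Fintype.ofFinite ι
  have hd : Dense (⋂ j, {γ : ι → ℝ | eval γ (P j) ≠ 0}) := by
    refine dense_iInter_of_isOpen
      (fun j => isOpen_ne_fun (MvPolynomial.continuous_eval _) continuous_const) fun j => ?_
    refine Metric.dense_iff.2 fun γ r hr => ?_
    by_contra hempty
    refine hP j (funext_set (fun i => Metric.ball (γ i) r)
      (fun i => infinite_of_mem_nhds _ (Metric.ball_mem_nhds _ hr)) fun γ' hγ' => ?_)
    rw [← ball_pi _ hr] at hγ'
    by_contra hne
    exact hempty ⟨γ', hγ', by simpa using hne⟩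
  obtain ⟨γ, hγ, hγP⟩ := hd.inter_open_nonempty (Set.pi univ fun _ => Ioi (0 : ℝ))
    (isOpen_set_pi finite_univ fun _ _ => isOpen_Ioi) ⟨fun _ => 1, fun _ _ => mem_Ioi.2 one_pos⟩
  exact ⟨γ, fun i => hγ i (mem_univ i), mem_iInter.1 hγP⟩

variable {d : ℕ} {T : Set (Fin d → ℝ)} {ι : Type*} [Fintype ι]

/-- The projection of the cube `T ^ ι` to `ℝ ^ d` with weights `γ`. -/
def proj (γ : ι → ℝ) (z : ι → T) : Fin d → ℝ := ∑ i, γ i • (z i : Fin d → ℝ)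

/-- The projection of a line is a homothetic copy of `T`, its ratio being the total weight of the
active coordinates. -/
lemma isHomotheticCopy_proj {γ : ι → ℝ} (hγ : ∀ i, 0 < γ i) (e : Line T ι) :
    IsHomotheticCopy T (proj γ '' range e) := by
  obtain ⟨i₀, hi₀⟩ := e.proper
  refine ⟨∑ i, (e.idxFun i).elim 0 fun t => γ i • (t : Fin d → ℝ),
    ∑ i, if e.idxFun i = none then γ i else 0, ?_, ?_⟩
  · refine Finset.sum_pos' (fun i _ => ?_) ⟨i₀, Finset.mem_univ _, by simp [hi₀, hγ]⟩
    split_ifs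
    exacts [(hγ i).le, le_rfl]
  · have key : ∀ t : T, proj γ (e t) = (∑ i, (e.idxFun i).elim 0 fun t => γ i • (t : Fin d → ℝ)) +
        (∑ i, if e.idxFun i = none then γ i else 0) • (t : Fin d → ℝ) := by
      intro t
      rw [proj, Finset.sum_smul, ← Finset.sum_add_distrib]
      refine Finset.sum_congr rfl fun i _ => ?_
      cases h : e.idxFun i <;> simp [h]
    ext p
    constructor
    · rintro ⟨_, ⟨t, rfl⟩, rfl⟩
      exact ⟨t, t.2, (key t).symm⟩
    · rintro ⟨t, ht, rfl⟩
      exact ⟨_, ⟨⟨t, ht⟩, rfl⟩, key ⟨t, ht⟩⟩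

/-- The value of `f` at the projections of `z` and `z'` is a polynomial in the weights. It is
nonzero since it takes a nonzero value where a single coordinate at which `z` and `z'` differ has
weight `1` and the others have weight `0`. Hence generic weights keep `F` respected. -/
lemma exists_weights_eval_ne_zero [Finite T] {F : Set (MvPolynomial (Fin d ⊕ Fin d) ℝ)}
    (hF : F.Countable) (hFT : Respects F T) :
    ∃ γ : ι → ℝ, (∀ i, 0 < γ i) ∧ ∀ f ∈ F, ∀ z z' : ι → T, z ≠ z' →
      eval (Sum.elim (proj γ z) (proj γ z')) f ≠ 0 := by
  classical
  have := hF.to_subtype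
  let coord : (ι → T) → Fin d → MvPolynomial ι ℝ := fun z j => ∑ i, C ((z i : Fin d → ℝ) j) * X i
  have hcoord : ∀ γ z j, eval γ (coord z j) = proj γ z j := fun γ z j => by
    simp [coord, proj, mul_comm]
  let Q : F × {w : (ι → T) × (ι → T) // w.1 ≠ w.2} → MvPolynomial ι ℝ :=
    fun p => bind₁ (Sum.elim (coord p.2.1.1) (coord p.2.1.2)) p.1.1
  have hQ : ∀ γ p, eval γ (Q p) =
      eval (Sum.elim (proj γ p.2.1.1) (proj γ p.2.1.2)) p.1.1 := by
    intro γ p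
    rw [← coe_aeval_eq_eval, RingHom.coe_coe, aeval_bind₁, ← coe_aeval_eq_eval, RingHom.coe_coe]
    congr 2
    funext s
    cases s <;> simp [aeval_eq_eval, hcoord]
  obtain ⟨γ, hγ, hγQ⟩ := exists_pos_forall_eval_ne_zero Q fun p hp => by
    obtain ⟨i, hi⟩ := Function.ne_iff.1 p.2.2
    have hsingle : ∀ z : ι → T, proj (Pi.single i 1) z = z i := fun z => by
      simp [proj, Pi.single_apply]
    refine hFT p.1.1 p.1.2 _ (p.2.1.1 i).2 _ (p.2.1.2 i).2 (fun h => hi (Subtype.ext h)) ?_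
    rw [← hsingle, ← hsingle, ← hQ, hp, map_zero]
  exact ⟨γ, hγ, fun f hf z z' hz => hQ γ (⟨f, hf⟩, ⟨(z, z'), hz⟩) ▸ hγQ _⟩

/-- The squared distance is a polynomial that may be added to every respected family. Respecting it
makes the projection injective. -/
lemma exists_weights_injective_respects [Finite T] {F : Set (MvPolynomial (Fin d ⊕ Fin d) ℝ)}
    (hF : F.Countable) (hFT : Respects F T) :
    ∃ γ : ι → ℝ, (∀ i, 0 < γ i) ∧ Function.Injective (proj γ : (ι → T) → Fin d → ℝ) ∧
      Respects F (range (proj γ : (ι → T) → Fin d → ℝ)) := by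
  let D : MvPolynomial (Fin d ⊕ Fin d) ℝ := ∑ j, (X (Sum.inl j) - X (Sum.inr j)) ^ 2
  have hD : ∀ p q, eval (Sum.elim p q) D = ∑ j, (p j - q j) ^ 2 := fun p q => by simp [D]
  have hDT : Respects (insert D F) T := by
    rintro f (rfl | hf) p hp q hq hpq
    · obtain ⟨j, hj⟩ := Function.ne_iff.1 hpq
      rw [hD]
      exact (Finset.sum_pos' (fun _ _ => sq_nonneg _)
        ⟨j, Finset.mem_univ _, by have := sub_ne_zero.2 hj; positivity⟩).ne'
    · exact hFT f hf p hp q hq hpq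
  obtain ⟨γ, hγ, hγF⟩ := exists_weights_eval_ne_zero (ι := ι) (hF.insert D) hDT
  refine ⟨γ, hγ, fun z z' h => ?_, ?_⟩
  · by_contra hne
    exact hγF D (mem_insert _ _) z z' hne (by rw [hD, h]; simp)
  · rintro f hf _ ⟨z, rfl⟩ _ ⟨z', rfl⟩ hne
    exact hγF f (mem_insert_of_mem _ hf) z z' fun h => hne (congrArg _ h)

end Projection

end SparseGallai

theorem mainTheorem4 (d : ℕ) (T : Set (Fin d → ℝ)) (hT : T.Finite) (hT3 : 3 ≤ T.ncard)
    (F : Set (MvPolynomial (Fin d ⊕ Fin d) ℝ)) (hF : F.Countable)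
    (hFT : SparseGallai.Respects F T) (g k : ℕ) (hg : 0 < g) (hk : 0 < k) :
    ∃ (X : Set (Fin d → ℝ)) (𝒯 : Set (Set (Fin d → ℝ))),
      X.Finite ∧
      (∀ S ∈ 𝒯, SparseGallai.IsHomotheticCopy T S ∧ S ⊆ X) ∧
      SparseGallai.Respects F X ∧
      (∀ (l : ℕ) (C : Fin l → Set (Fin d → ℝ)), l < g → (∀ i, C i ∈ 𝒯) →
        ¬ SparseGallai.IsCycle X C) ∧
      (∀ c : X → Fin k, ∃ S ∈ 𝒯, SparseGallai.IsMonochromatic c S) := by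
  have := hT.to_subtype
  have : NeZero k := ⟨hk.ne'⟩
  obtain ⟨ι, hι, E, hE, hmono⟩ := SparseGallai.sparseHalesJewett g T (Fin k)
  have := Fintype.ofFinite ι
  obtain ⟨γ, hγ, hinj, hresp⟩ :=
    SparseGallai.exists_weights_injective_respects (ι := ι) hF hFT
  refine ⟨range (SparseGallai.proj γ : (ι → T) → _),
    (fun e : Line T ι => SparseGallai.proj γ '' range e) '' E, finite_range _, ?_, hresp, ?_, ?_⟩
  · rintro _ ⟨e, -, rfl⟩
    exact ⟨SparseGallai.isHomotheticCopy_proj hγ e, image_subset_range _ _⟩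
  · refine fun l C hl hC => hE.not_isCycle hinj hl fun i => ?_
    obtain ⟨e, he, heC⟩ := hC i
    exact ⟨⟨e, he⟩, heC.symm⟩
  · intro c
    obtain ⟨e, he, κ, hκ⟩ := hmono fun z => c ⟨SparseGallai.proj γ z, z, rfl⟩
    refine ⟨_, ⟨e, he, rfl⟩, ?_⟩
    rintro ⟨_, _⟩ ⟨_, _⟩ ⟨_, ⟨a, rfl⟩, rfl⟩ ⟨_, ⟨b, rfl⟩, rfl⟩
    exact (hκ a).trans (hκ b).symm
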